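/- Let $n\ge 1$, $0\le m\le n$ and $k\ge 0$ be integers with $n-k$ even, and write $[n]=\{1,\dots,n\}$. Cycles of a permutation include its fixed points (so for $n=1$ the identity is an $n$-cycle), and a permutation is said to separate $[m]$ if the elements of $[m]$ lie in pairwise distinct cycles of it. Let $p^{(n)}_{m,k}$ be the number of pairs $(s,\pi)$ of permutations of $[n]$ such that $s$ is an $n$-cycle, $s\pi^{-1}$ is an $n$-cycle, and $\pi$ has exactly $k$ cycles and separates $[m]$ (equivalently, $p^{(n)}_{m,k}$ is the number of ordered pairs of $n$-cycles on $[n]$ whose product has exactly $k$ cycles and separates $[m]$). Let $C_m(N,k)$ be the number of permutations of $[N]$ that have exactly $k$ cycles and separate $[m]$. Then $$p^{(n)}_{m,k}=\frac{2\,(n-1)!\,C_m(n+1,k)}{(n+m)(n+1-m)}.$$ -/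

import Mathlib

namespace PlanePerm

/-- The number of cycles `C(π)` of a permutation `π` of `[n]`, i.e. the number of orbits of the
cyclic group generated by `π` (fixed points count as cycles of length one). -/
noncomputable def numCycles {n : ℕ} (π : Equiv.Perm (Fin n)) : ℕ :=
  Nat.card (Quotient (Equiv.Perm.SameCycle.setoid π))

/-- The elements of `[m]`, i.e. the first `m` elements of `[n]`, lie in pairwise distinct cycles
of `π`. (The element `i : Fin n` stands for the number `i + 1`.) -/
def Separates {n : ℕ} (m : ℕ) (π : Equiv.Perm (Fin n)) : Prop :=
  ∀ i j : Fin n, i.val < m → j.val < m → i ≠ j → ¬ π.SameCycle i j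

/-- `s` is an `n`-cycle, i.e. has cycle type `n¹`: all of `[n]` is one single cycle of `s`.
For `n = 1` the identity is a `1`-cycle. -/
def IsLongCycle {n : ℕ} (s : Equiv.Perm (Fin n)) : Prop :=
  s.IsCycleOn Set.univ

/-- `C_m(n, k)`: the number of permutations of `[n]` with `k` cycles which have the elements of
`[m]` in distinct cycles. -/
noncomputable def sepCount (m n k : ℕ) : ℕ :=
  Nat.card {π : Equiv.Perm (Fin n) // numCycles π = k ∧ Separates m π}

/-- A plane permutation on `[n]`: a pair `(s, π)` of an `n`-cycle `s` and an arbitrary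
permutation `π`. -/
structure PlanePermutation (n : ℕ) where
  /-- the upper horizontal -/
  s : Equiv.Perm (Fin n)
  /-- the vertical -/
  vertical : Equiv.Perm (Fin n)
  isLongCycle : IsLongCycle s

/-- The diagonal `D = s π⁻¹` of a plane permutation `(s, π)`; it maps `π (s_{i-1})` to `s_i`. -/
def PlanePermutation.diagonal {n : ℕ} (p : PlanePermutation n) : Equiv.Perm (Fin n) :=
  p.s * p.vertical⁻¹

/-- `p^{(n)}_{m,k}`: the number of plane permutations on `[n]` whose diagonal is an `n`-cycle and
whose vertical has `k` cycles, with the elements of `[m]` in distinct cycles of the vertical. -/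
noncomputable def planeCount (m n k : ℕ) : ℕ :=
  Nat.card {p : PlanePermutation n //
    IsLongCycle p.diagonal ∧ numCycles p.vertical = k ∧ Separates m p.vertical}

end PlanePerm

/-! Count in two ways the factorizations `π = s * c` on `n + 1` points, where `s` is an `(n +
1)`-cycle, `c` is an `n`-cycle fixing some point `j`, and `π` has `k` cycles and separates `M =
[m]`.

By parity every such `π` is odd, so Boccara's theorem (`sum_factorCount_erase`) gives each one `2 (n
- 1)!` factorizations, hence `2 (n - 1)! C_m(n + 1, k)` in total.

Conversely, `c j = j` forces `π j = s j = i ≠ j`. Left multiplication by `swap j i` splices `j` out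
of both `s` and `π`, leaving two `n`-cycles on the other points whose product has `k` cycles there.
If `j ∉ M`, all `n` values of `i` are allowed. If `j ∈ M`, then `i ∉ M`, and `i` replaces `j` in the
set to be separated. The number of pairs `(j, i)` is thus `(n + 1 - m) n + m (n + 1 - m) = (n + 1 -
m)(n + m)`, and by symmetry each contributes `p` (`sum_separatesOn_factorCount`).

Boccara's theorem is proved by induction, removing a moved point from both factors;
`factorCount_erase_eq_sum` supplies the terms that this removal misses. -/

namespace PlanePerm

open Equiv Equiv.Perm Finset

/-! ### Splicing a fixed point into a cycle. -/

section Insertion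

variable {α : Type*}

/-- An equivalence relation that relates every point to its image contains `SameCycle`. -/
theorem sameCycle_le_of_forall {σ : Perm α} (r : Setoid α) (h : ∀ a, r a (σ a)) {a b : α}
    (hab : σ.SameCycle a b) : r a b := by
  obtain ⟨i, rfl⟩ := hab
  induction i with
  | zero => exact r.refl _
  | succ i ih =>
    rw [add_comm, zpow_add, zpow_one, Perm.mul_apply]
    exact r.trans ih (h _)
  | pred i ih =>
    refine r.trans ih (r.symm ?_)
    convert h ((σ ^ (-(i : ℤ) - 1)) a) using 1
    rw [← Perm.mul_apply, ← zpow_one_add]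
    congr 2
    ring

theorem not_sameCycle_of_fixed {π : Perm α} {v a : α} (hv : π v = v) (ha : a ≠ v) :
    ¬ π.SameCycle a v := by
  intro h
  exact ha (h.eq_of_right hv)

variable [DecidableEq α]

theorem swap_mul_apply_left {π : Perm α} {v x : α} (hv : π v = v) : (swap v x * π) v = x := by
  simp [hv]

/-- Inserting the fixed point `v` of `π` in front of `x` leaves the cycles of `π` unchanged away
from `v`. -/
theorem sameCycle_swap_mul_iff {π : Perm α} {v x a b : α} (hv : π v = v)
    (hx : x ≠ v) (ha : a ≠ v) (hb : b ≠ v) :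
    (swap v x * π).SameCycle a b ↔ π.SameCycle a b := by
  constructor
  · intro h
    -- Retracting `v` onto `x` turns each step of `swap v x * π` into a step of `π` or no step at
    -- all.
    have key := sameCycle_le_of_forall (σ := swap v x * π)
      ((SameCycle.setoid π).comap (fun c => if c = v then x else c)) (fun c => ?_) h
    · change π.SameCycle (if a = v then x else a) (if b = v then x else b) at key
      rwa [if_neg ha, if_neg hb] at key
    · change π.SameCycle (if c = v then x else c)
        (if (swap v x * π) c = v then x else (swap v x * π) c)
      by_cases hc : c = v
      · subst hc
        simp [hv, hx, SameCycle.refl]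
      · have hcv : π c ≠ v := fun h' => hc (π.injective (h'.trans hv.symm))
        by_cases hcx : π c = x
        · rw [if_neg hc, Perm.mul_apply, hcx, swap_apply_right, if_pos rfl, ← hcx]
          exact sameCycle_apply_right.2 (SameCycle.refl _ _)
        · rw [if_neg hc, Perm.mul_apply, swap_apply_of_ne_of_ne hcv hcx, if_neg hcv]
          exact sameCycle_apply_right.2 (SameCycle.refl _ _)
  · intro h
    refine sameCycle_le_of_forall (SameCycle.setoid (swap v x * π)) (fun c => ?_) h
    change (swap v x * π).SameCycle c (π c)
    by_cases hc : c = v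
    · subst hc; rw [hv]
    · have hcv : π c ≠ v := fun h' => hc (π.injective (h'.trans hv.symm))
      by_cases hcx : π c = x
      · have h1 : (swap v x * π) c = v := by simp [hcx]
        have h2 : (swap v x * π) v = x := swap_mul_apply_left hv
        have h3 : (swap v x * π).SameCycle c v := by
          nth_rw 2 [← h1]
          exact sameCycle_apply_right.2 (SameCycle.refl _ _)
        have h4 := sameCycle_apply_right.2 h3
        rw [h2] at h4
        rwa [hcx]
      · have h1 : (swap v x * π) c = π c := by
          rw [Perm.mul_apply, swap_apply_of_ne_of_ne hcv hcx]
        rw [← h1]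
        exact sameCycle_apply_right.2 (SameCycle.refl _ _)

theorem sameCycle_swap_mul_self {π : Perm α} {v x : α} (hv : π v = v) :
    (swap v x * π).SameCycle v x := by
  nth_rw 2 [← swap_mul_apply_left (x := x) hv]
  exact sameCycle_apply_right.2 (SameCycle.refl _ _)

end Insertion

/-! ### Single cycles on a finite set of points. -/

section LongOn

variable {α : Type*} [DecidableEq α]

/-- `σ` permutes `S` in a single cycle and fixes all other points. -/
def LongOn (S : Finset α) (σ : Perm α) : Prop :=
  (∀ a ∉ S, σ a = a) ∧ ∀ a ∈ S, ∀ b ∈ S, σ.SameCycle a b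

theorem LongOn.apply_mem {S : Finset α} {σ : Perm α} (h : LongOn S σ) {a : α} (ha : a ∈ S) :
    σ a ∈ S := by
  by_contra hn
  rw [σ.injective (h.1 _ hn)] at hn
  exact hn ha

omit [DecidableEq α] in
theorem LongOn.apply_ne {S : Finset α} {σ : Perm α} (h : LongOn S σ) {a b : α} (ha : a ∈ S)
    (hb : b ∈ S) (hab : a ≠ b) : σ a ≠ a :=
  fun hf => not_sameCycle_of_fixed hf hab.symm (h.2 b hb a ha)

theorem longOn_swap_mul_iff {S : Finset α} {π : Perm α} {v x : α} (hv : π v = v) (hvS : v ∈ S)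
    (hxS : x ∈ S) (hx : x ≠ v) :
    LongOn S (swap v x * π) ↔ LongOn (S.erase v) π := by
  have hne : ∀ {a}, a ≠ v → π a ≠ v := fun ha h' => ha (π.injective (h'.trans hv.symm))
  constructor
  · rintro ⟨h1, h2⟩
    refine ⟨fun a ha => ?_, fun a ha b hb => ?_⟩
    · by_cases hav : a = v
      · rw [hav, hv]
      have haS : a ∉ S := fun h => ha (mem_erase.2 ⟨hav, h⟩)
      have := h1 a haS
      rw [Perm.mul_apply, swap_apply_eq_iff] at this
      rw [this, swap_apply_of_ne_of_ne hav (fun h => haS (h ▸ hxS))]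
    · rw [mem_erase] at ha hb
      exact (sameCycle_swap_mul_iff hv hx ha.1 hb.1).1 (h2 a ha.2 b hb.2)
  · rintro ⟨h1, h2⟩
    refine ⟨fun a ha => ?_, ?_⟩
    · have hav : a ≠ v := fun h => ha (h ▸ hvS)
      rw [Perm.mul_apply, h1 a (fun h => ha (mem_of_mem_erase h)),
        swap_apply_of_ne_of_ne hav (fun h => ha (h ▸ hxS))]
    · have key : ∀ a ∈ S, (swap v x * π).SameCycle a x := by
        intro a ha
        by_cases hav : a = v
        · rw [hav]; exact sameCycle_swap_mul_self hv
        · exact (sameCycle_swap_mul_iff hv hx hav hx).2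
            (h2 a (mem_erase.2 ⟨hav, ha⟩) x (mem_erase.2 ⟨hx, hxS⟩))
      exact fun a ha b hb => (key a ha).trans (key b hb).symm

omit [DecidableEq α] in
theorem longOn_conj_iff {S T : Finset α} {σ : Perm α} (τ : Perm α)
    (hT : ∀ a, τ a ∈ T ↔ a ∈ S) : LongOn T (τ * σ * τ⁻¹) ↔ LongOn S σ := by
  have hT' : ∀ a, τ⁻¹ a ∈ S ↔ a ∈ T := fun a => by rw [← hT]; simp
  constructor
  · rintro ⟨h1, h2⟩
    refine ⟨fun a ha => ?_, fun a ha b hb => ?_⟩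
    · have := h1 (τ a) (fun h => ha ((hT a).1 h))
      simpa using this
    · have := h2 (τ a) ((hT a).2 ha) (τ b) ((hT b).2 hb)
      simpa [sameCycle_conj] using this
  · rintro ⟨h1, h2⟩
    refine ⟨fun a ha => ?_, fun a ha b hb => ?_⟩
    · have := h1 (τ⁻¹ a) (fun h => ha ((hT' a).1 h))
      rw [Perm.mul_apply, Perm.mul_apply, this]
      exact τ.apply_symm_apply a
    · rw [sameCycle_conj]
      exact h2 _ ((hT' a).2 ha) _ ((hT' b).2 hb)

theorem longOn_singleton_iff {a : α} {σ : Perm α} : LongOn {a} σ ↔ σ = 1 := by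
  constructor
  · rintro h
    ext b
    by_cases hb : b = a
    · have := h.apply_mem (mem_singleton_self a)
      rw [hb]; simpa using this
    · exact h.1 b (by simpa using hb)
  · rintro rfl
    refine ⟨by simp, ?_⟩
    intro b hb c hc
    rw [mem_singleton] at hb hc
    rw [hb, hc]

end LongOn

/-! ### Factorizations into two long cycles, and Boccara's theorem. -/

section Factorizations

variable {α : Type*} [Fintype α] [DecidableEq α]

open Classical in
/-- The number of factorizations `π = s * c` with `s` a long cycle on `S` and `c` a long cycle
on `C`. -/
noncomputable def factorCount (S C : Finset α) (π : Perm α) : ℕ :=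
  ∑ s : Perm α, if LongOn S s ∧ LongOn C (s⁻¹ * π) then 1 else 0

theorem factorCount_conj {S C S' C' : Finset α} (τ π : Perm α)
    (hS : ∀ a, τ a ∈ S' ↔ a ∈ S) (hC : ∀ a, τ a ∈ C' ↔ a ∈ C) :
    factorCount S' C' (τ * π * τ⁻¹) = factorCount S C π := by
  classical
  unfold factorCount
  rw [← Equiv.sum_comp (MulAut.conj τ).toEquiv]
  refine sum_congr rfl fun s _ => ?_
  have h1 : (MulAut.conj τ).toEquiv s = τ * s * τ⁻¹ := rfl
  have h2 : (τ * s * τ⁻¹)⁻¹ * (τ * π * τ⁻¹) = τ * (s⁻¹ * π) * τ⁻¹ := by group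
  rw [h1, h2, longOn_conj_iff τ hS, longOn_conj_iff τ hC]

theorem factorCount_eq_zero {S C : Finset α} {π : Perm α} {v x : α} (hv : v ∈ S) (hx : x ∈ S)
    (hxv : x ≠ v) (hC : v ∉ C) (hπ : π v = v) : factorCount S C π = 0 := by
  classical
  refine sum_eq_zero fun s _ => if_neg ?_
  rintro ⟨hs, hc⟩
  have h := hc.1 v hC
  rw [Perm.mul_apply, hπ, Perm.inv_eq_iff_eq] at h
  exact hs.apply_ne hv hx hxv.symm h.symm

/-- Deleting a fixed point of the second factor from the first factor. -/
theorem factorCount_delete {S C : Finset α} {π : Perm α} {v : α} (hv : v ∈ S) (hw : π v ∈ S)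
    (hC : v ∉ C) (hπ : π v ≠ v) :
    factorCount S C π = factorCount (S.erase v) C (swap v (π v) * π) := by
  classical
  unfold factorCount
  -- As the second factor fixes `v`, the first agrees with `π` at `v`, so the same transposition
  -- splices `v` out of both.
  rw [← Equiv.sum_comp (Equiv.mulLeft (swap v (π v)))]
  refine sum_congr rfl fun s _ => ?_
  have h2 : (swap v (π v) * s)⁻¹ * π = s⁻¹ * (swap v (π v) * π) := by
    rw [mul_inv_rev, swap_inv, mul_assoc]
  rw [Equiv.coe_mulLeft, h2]
  congr 1
  rw [eq_iff_iff]
  refine and_congr_left fun hc => longOn_swap_mul_iff ?_ hv hw hπ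
  have h := hc.1 v hC
  rw [Perm.mul_apply, Perm.mul_apply, swap_apply_right, Perm.inv_eq_iff_eq] at h
  exact h.symm

/-- Removing `v` from the second factor. -/
theorem factorCount_insert {S C : Finset α} (π : Perm α) {v : α} (hv : v ∉ C)
    (hC : C.Nonempty) :
    factorCount S (insert v C) π = ∑ x ∈ C, factorCount S C (π * swap v x) := by
  classical
  unfold factorCount
  rw [sum_comm]
  refine sum_congr rfl fun s _ => ?_
  by_cases hs : LongOn S s
  swap
  · simp [hs]
  simp only [hs, true_and, ← mul_assoc]
  set c := s⁻¹ * π with hc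
  -- `c * swap v x` fixes `v` only when `x` is the predecessor of `v` under `c`, so at most one
  -- summand is nonzero.
  have key : ∀ x ∈ C, c x = v → (LongOn C (c * swap v x) ↔ LongOn (insert v C) c) := by
    intro x hx hcx
    have hxv : x ≠ v := fun h => hv (h ▸ hx)
    have hfix : (c * swap v x) v = v := by simp [hcx]
    have hcv : c v ≠ v := fun h => hxv (c.injective (hcx.trans h.symm))
    have e : swap v (c v) * (c * swap v x) = c := by
      rw [mul_swap_eq_swap_mul, ← mul_assoc, hcx, swap_comm, swap_mul_self, one_mul]
    by_cases hcvC : c v ∈ C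
    · have := longOn_swap_mul_iff (S := insert v C) (x := c v) hfix (mem_insert_self _ _)
        (mem_insert_of_mem hcvC) hcv
      rw [e, erase_insert hv] at this
      exact this.symm
    · constructor
      · intro h
        have := h.apply_mem hx
        simp at this
        exact absurd this hcvC
      · intro h
        rcases mem_insert.1 (h.apply_mem (mem_insert_self v C)) with h' | h'
        · exact absurd h' hcv
        · exact absurd h' hcvC
  have hval : ∀ x, LongOn C (c * swap v x) → c x = v := fun x h => by
    simpa using h.1 v hv
  by_cases hL : LongOn (insert v C) c
  · rw [if_pos hL]
    obtain ⟨y, hy⟩ := hC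
    have hmem : c⁻¹ v ∈ C := by
      have h1 : c⁻¹ v ∈ insert v C := by
        by_contra hn
        have := hL.1 _ hn
        rw [show c (c⁻¹ v) = v from c.apply_symm_apply v] at this
        exact hn (this ▸ mem_insert_self _ _)
      rcases mem_insert.1 h1 with h | h
      · rw [Perm.inv_eq_iff_eq] at h
        exact absurd h.symm (hL.apply_ne (mem_insert_self _ _) (mem_insert_of_mem hy)
          (fun h => hv (h ▸ hy)))
      · exact h
    rw [sum_eq_single_of_mem _ hmem, if_pos ((key _ hmem (by simp)).2 hL)]
    intro b _ hb
    refine if_neg fun h => hb ?_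
    rw [eq_comm, Perm.inv_eq_iff_eq]
    exact (hval b h).symm
  · rw [if_neg hL]
    exact (sum_eq_zero fun x hx => if_neg fun h => hL ((key x hx (hval x h)).1 h)).symm

-- Matches the two orders of deletion in `factorCount_erase_eq_sum`: `v` then `x`, against `v` then
-- `π v`. After cancellation it rests on `π * swap v x = swap (π v) (π x) * π`.
omit [Fintype α] in
theorem conj_delete_delete {π : Perm α} {v x : α} (hxv : x ≠ v) (hwv : π v ≠ v)
    (hyv : π x ≠ v) :
    swap (π v) x * (swap x (π v) * (swap v (π x) * (π * swap v x))) * (swap (π v) x)⁻¹ =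
      swap (π v) (π x) * ((swap v (π v) * π) * swap (π v) x) := by
  have hyw : π v ≠ π x := fun h => hxv (π.injective h.symm)
  have h1 : swap (π v) (π x) * swap v (π v) = swap v (π x) * swap (π v) (π x) := by
    rw [mul_swap_eq_swap_mul, swap_apply_left, swap_apply_of_ne_of_ne hwv.symm hyv.symm]
  rw [swap_inv, swap_comm x (π v), ← mul_assoc (swap (π v) x), swap_mul_self, one_mul,
    mul_swap_eq_swap_mul π, ← mul_assoc, ← mul_assoc, ← mul_assoc, h1]

omit [Fintype α] in
theorem swap_apply_mem_erase_iff {S : Finset α} {w x : α} (hw : w ∈ S) (hx : x ∈ S) (a : α) :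
    swap w x a ∈ S.erase w ↔ a ∈ S.erase x := by
  by_cases h1 : a = w
  · subst h1; simp [hw, hx, eq_comm]
  by_cases h2 : a = x
  · subst h2; simp
  · rw [swap_apply_of_ne_of_ne h1 h2]; simp [h1, h2]

/-- The factorizations whose second factor fixes a given point `v` that `π` moves, expressed by
those in which `v` lies on a transposition of the second factor. -/
theorem factorCount_erase_eq_sum {S : Finset α} {π : Perm α} (hπ : ∀ a ∉ S, π a = a)
    {v : α} (hv : v ∈ S) (hwv : π v ≠ v) (hcard : 3 ≤ S.card) :
    factorCount S (S.erase v) π =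
      ∑ x ∈ S.erase v, factorCount S ((S.erase v).erase x) (π * swap v x) := by
  have hmem : ∀ a ∈ S, π a ∈ S := fun a ha => by
    by_contra hn
    rw [π.injective (hπ _ hn)] at hn
    exact hn ha
  have hw := hmem v hv
  have hw' : π v ∈ S.erase v := mem_erase.2 ⟨hwv, hw⟩
  have hcard' : 1 < (S.erase v).card := by rw [card_erase_of_mem hv]; omega
  have hcard'' : 0 < ((S.erase v).erase (π v)).card := by rw [card_erase_of_mem hw']; omega
  obtain ⟨z, hz, hzw⟩ := exists_mem_ne hcard' (π v)
  rw [factorCount_delete hv hw (notMem_erase _ _) hwv]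
  nth_rw 2 [← insert_erase hw']
  rw [factorCount_insert _ (notMem_erase _ _) (card_pos.1 hcard''),
    ← sum_erase (s := S.erase v) (a := π v)]
  · refine sum_congr rfl fun x hx => ?_
    rw [mem_erase, mem_erase] at hx
    obtain ⟨hxw, hxv, hxS⟩ := hx
    have hx' : x ∈ S.erase v := mem_erase.2 ⟨hxv, hxS⟩
    have hyw : π x ≠ π v := fun h => hxv (π.injective h)
    by_cases hy : π x = v
    · rw [factorCount_eq_zero hw' hz hzw (notMem_erase _ _) (by simp [hy]),
        factorCount_eq_zero hv hw hwv (by simp) (by simp [hy])]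
    · have e1 : (π * swap v x) v = π x := by simp
      have e2 : (swap v (π v) * π * swap (π v) x) (π v) = π x := by
        simp [swap_apply_of_ne_of_ne hy hyw]
      have e3 : (swap v (π x) * (π * swap v x)) x = π v := by
        simp [swap_apply_of_ne_of_ne hwv hyw.symm]
      have d1 := factorCount_delete (C := (S.erase v).erase x) hv
        (by rw [e1]; exact hmem x hxS) (by simp) (by rw [e1]; exact hy)
      have d2 := factorCount_delete (C := (S.erase v).erase x) hx'
        (by rw [e3]; exact hw') (by simp) (by rw [e3]; exact hxw.symm)
      have d3 := factorCount_delete (C := (S.erase v).erase (π v)) hw'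
        (by rw [e2]; exact mem_erase.2 ⟨hy, hmem x hxS⟩) (by simp) (by rw [e2]; exact hyw)
      rw [d1, e1, d2, e3, d3, e2, ← conj_delete_delete hxv hwv hy]
      exact factorCount_conj _ _ (swap_apply_mem_erase_iff hw' hx')
        (swap_apply_mem_erase_iff hw' hx')
  -- The extra summand `x = π v` vanishes: the product fixes `v`, or fixes `π v` once `v` is
  -- deleted, while the first factor must move that point.
  · have e1 : (π * swap v (π v)) v = π (π v) := by simp
    by_cases hy : π (π v) = v
    · exact factorCount_eq_zero hv hw hwv (by simp) (by simp [hy])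
    · rw [factorCount_delete hv (by rw [e1]; exact hmem _ hw) (by simp) (by rw [e1]; exact hy), e1]
      refine factorCount_eq_zero hw' hz hzw (notMem_erase _ _) ?_
      simp [swap_apply_of_ne_of_ne hwv (fun h => hwv (π.injective h.symm))]

/-- **Boccara's theorem**: an odd permutation of `n` points is the product of an `n`-cycle and an
`(n - 1)`-cycle in `2 (n - 2)!` ways. -/
theorem sum_factorCount_erase (N : ℕ) : ∀ {S : Finset α} {π : Perm α}, S.card = N + 2 →
    (∀ a ∉ S, π a = a) → sign π = -1 →
    ∑ j ∈ S, factorCount S (S.erase j) π = 2 * N.factorial := by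
  induction N with
  | zero =>
    intro S π hS hπ hsign
    have hne : π ≠ 1 := by rintro rfl; simp at hsign
    obtain ⟨v, hwv⟩ : ∃ v, π v ≠ v := by
      by_contra! h
      exact hne (Perm.ext h)
    have hw : π (π v) ≠ π v := fun h => hwv (π.injective h)
    have hS' : {v, π v} = S := by
      refine eq_of_subset_of_card_le (insert_subset_iff.2 ⟨?_, singleton_subset_iff.2 ?_⟩) ?_
      · by_contra h
        exact hwv (hπ v h)
      · by_contra h
        exact hw (hπ _ h)
      · rw [card_pair hwv.symm, hS]
    have hlong : LongOn S π := by
      refine ⟨hπ, ?_⟩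
      have key : ∀ a ∈ S, π.SameCycle v a := by
        intro a ha
        rw [← hS', mem_insert, mem_singleton] at ha
        rcases ha with rfl | rfl
        · exact SameCycle.refl _ _
        · exact sameCycle_apply_right.2 (SameCycle.refl _ _)
      exact fun a ha b hb => (key a ha).symm.trans (key b hb)
    -- Here `π` is a transposition and the second factor is trivial, so each of the two points gives
    -- one factorization.
    have : ∀ j ∈ S, factorCount S (S.erase j) π = 1 := by
      intro j hj
      obtain ⟨i, hi⟩ := card_eq_one.1 (show (S.erase j).card = 1 by
        rw [card_erase_of_mem hj, hS])
      classical
      rw [hi]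
      unfold factorCount
      simp_rw [longOn_singleton_iff, inv_mul_eq_one]
      rw [sum_eq_single π]
      · simp [hlong]
      · intro s _ hs
        simp [hs]
      · simp
    rw [sum_congr rfl this]
    simp [hS]
  | succ N ih =>
    intro S π hS hπ hsign
    have hne : π ≠ 1 := by rintro rfl; simp at hsign
    obtain ⟨v, hwv⟩ : ∃ v, π v ≠ v := by
      by_contra! h
      exact hne (Perm.ext h)
    have hv : v ∈ S := by
      by_contra h
      exact hwv (hπ v h)
    have hmem : ∀ a ∈ S, π a ∈ S := fun a ha => by
      by_contra hn
      rw [π.injective (hπ _ hn)] at hn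
      exact hn ha
    have hcard : (S.erase v).card = N + 2 := by rw [card_erase_of_mem hv, hS]; rfl
    have hu : π⁻¹ v ∈ S.erase v := by
      refine mem_erase.2 ⟨fun h => ?_, ?_⟩
      · rw [Perm.inv_eq_iff_eq] at h
        exact hwv h.symm
      · by_contra hn
        have := hπ _ hn
        rw [show π (π⁻¹ v) = v from π.apply_symm_apply v] at this
        exact hn (this ▸ hv)
    have step : ∀ j ∈ S.erase v, factorCount S (S.erase j) π =
        ∑ x ∈ (S.erase v).erase j, factorCount S ((S.erase v).erase j) (π * swap v x) := by
      intro j hj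
      have h1 : S.erase j = insert v ((S.erase v).erase j) := by
        rw [erase_right_comm, insert_erase]
        exact mem_erase.2 ⟨(ne_of_mem_erase hj).symm, hv⟩
      rw [h1, factorCount_insert _ (by simp)]
      rw [← card_pos, card_erase_of_mem hj, hcard]
      omega
    -- The second factor fixes `v`, so `v` can be deleted from the first, leaving an odd permutation
    -- of `S.erase v` for the induction. If `x = π⁻¹ v`, the product fixes `v` as well, which is
    -- impossible.
    have inner : ∀ x ∈ S.erase v,
        ∑ j ∈ S.erase v, factorCount S ((S.erase v).erase j) (π * swap v x) =
          if x = π⁻¹ v then 0 else 2 * N.factorial := by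
      intro x hx
      have e1 : (π * swap v x) v = π x := by simp
      split_ifs with hxu
      · refine sum_eq_zero fun j _ => ?_
        refine factorCount_eq_zero hv (hmem v hv) hwv (by simp) ?_
        rw [e1, hxu]
        exact π.apply_symm_apply v
      · have hy : π x ≠ v := fun h => hxu (by rw [eq_comm, Perm.inv_eq_iff_eq, h])
        have hxS := mem_of_mem_erase hx
        have hxv := ne_of_mem_erase hx
        rw [← ih (S := S.erase v) (π := swap v (π x) * (π * swap v x)) hcard]
        · refine sum_congr rfl fun j _ => ?_
          rw [factorCount_delete hv (by rw [e1]; exact hmem x hxS) (by simp)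
            (by rw [e1]; exact hy), e1]
        · intro a ha
          by_cases hav : a = v
          · simp [hav]
          · have haS : a ∉ S := fun h => ha (mem_erase.2 ⟨hav, h⟩)
            have hax : a ≠ x := fun h => haS (h ▸ hxS)
            have hay : a ≠ π x := fun h => haS (h ▸ hmem x hxS)
            simp [swap_apply_of_ne_of_ne hav hax, hπ a haS, swap_apply_of_ne_of_ne hav hay]
        · rw [Perm.sign_mul, Perm.sign_mul, sign_swap hy.symm, sign_swap hxv.symm, hsign]
          rfl
    rw [← add_sum_erase S _ hv, sum_congr rfl step,
      factorCount_erase_eq_sum hπ hv hwv (by omega)]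
    have swapSum : ∑ j ∈ S.erase v, ∑ x ∈ (S.erase v).erase j,
          factorCount S ((S.erase v).erase j) (π * swap v x) =
        ∑ x ∈ S.erase v, ∑ j ∈ (S.erase v).erase x,
          factorCount S ((S.erase v).erase j) (π * swap v x) := by
      refine sum_comm' fun a b => ?_
      simp only [mem_erase]
      tauto
    -- The term `j = v` supplies exactly the diagonal `x = j` missing from the double sum.
    rw [swapSum, ← sum_add_distrib]
    rw [sum_congr rfl fun x hx => add_sum_erase (S.erase v)
      (fun j => factorCount S ((S.erase v).erase j) (π * swap v x)) hx, sum_congr rfl inner,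
      ← add_sum_erase _ _ hu, if_pos rfl, zero_add,
      sum_congr rfl fun x hx => if_neg (ne_of_mem_erase hx), sum_const, card_erase_of_mem hu,
      hcard, Nat.factorial_succ, smul_eq_mul]
    simp only [show N + 2 - 1 = N + 1 from rfl]
    ring

end Factorizations

/-! ### Number of cycles and sign. -/

section CycleCount

theorem card_quotient_eq_of_surjective {α β : Type*} {r : Setoid α} {r' : Setoid β} (f : α → β)
    (h : ∀ a b, r' (f a) (f b) ↔ r a b) (hs : ∀ b, ∃ a, r' (f a) b) :
    Nat.card (Quotient r) = Nat.card (Quotient r') := by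
  refine Nat.card_congr (Equiv.ofBijective
    (Quotient.map f fun a b hab => (h a b).2 hab) ⟨?_, ?_⟩)
  · rintro ⟨a⟩ ⟨b⟩ hab
    exact Quotient.sound ((h a b).1 (Quotient.exact hab))
  · rintro ⟨b⟩
    obtain ⟨a, ha⟩ := hs b
    exact ⟨Quotient.mk _ a, Quotient.sound ha⟩

theorem card_quotient_eq_add_one {α β : Type*} [Finite α] {r : Setoid α} {r' : Setoid β}
    (f : α → β) (v : β) (h : ∀ a b, r' (f a) (f b) ↔ r a b) (hv : ∀ a, ¬ r' (f a) v)
    (hs : ∀ b, r' v b ∨ ∃ a, r' (f a) b) :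
    Nat.card (Quotient r') = Nat.card (Quotient r) + 1 := by
  rw [← Finite.card_option]
  symm
  refine Nat.card_congr (Equiv.ofBijective
    (fun o : Option (Quotient r) => o.elim (Quotient.mk r' v)
      (Quotient.map f fun a b hab => (h a b).2 hab)) ⟨?_, ?_⟩)
  · rintro (_ | ⟨⟨a⟩⟩) (_ | ⟨⟨b⟩⟩) hab
    · rfl
    · exact absurd (r'.symm (Quotient.exact hab)) (hv b)
    · exact absurd (Quotient.exact hab) (hv a)
    · exact congrArg some (Quotient.sound ((h a b).1 (Quotient.exact hab)))
  · rintro ⟨b⟩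
    rcases hs b with hb | ⟨a, ha⟩
    · exact ⟨none, Quotient.sound hb⟩
    · exact ⟨some (Quotient.mk _ a), Quotient.sound ha⟩

/-- The number of cycles of a permutation, counting fixed points. -/
noncomputable def cycleCount {α : Type*} (π : Perm α) : ℕ :=
  Nat.card (Quotient (SameCycle.setoid π))

variable {α : Type*} [Finite α] [DecidableEq α]

theorem cycleCount_swap_mul {π : Perm α} {v x : α} (hv : π v = v) (hx : x ≠ v) :
    cycleCount π = cycleCount (swap v x * π) + 1 := by
  -- Away from `v` both permutations have the same cycles; `π` has `{v}` in addition.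
  have h1 : Nat.card (Quotient ((SameCycle.setoid π).comap (Subtype.val : {a // a ≠ v} → α))) =
      cycleCount (swap v x * π) := by
    refine card_quotient_eq_of_surjective Subtype.val
      (fun a b => sameCycle_swap_mul_iff hv hx a.2 b.2) fun b => ?_
    by_cases hb : b = v
    · exact ⟨⟨x, hx⟩, hb ▸ (sameCycle_swap_mul_self hv).symm⟩
    · exact ⟨⟨b, hb⟩, SameCycle.refl _ _⟩
  rw [← h1]
  refine card_quotient_eq_add_one Subtype.val v (fun a b => Iff.rfl)
    (fun a => not_sameCycle_of_fixed hv a.2) fun b => ?_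
  by_cases hb : b = v
  · exact Or.inl (hb ▸ SameCycle.refl _ _)
  · exact Or.inr ⟨⟨b, hb⟩, SameCycle.refl _ _⟩

omit [Finite α] [DecidableEq α] in
theorem cycleCount_one : cycleCount (1 : Perm α) = Nat.card α := by
  refine (Nat.card_congr (Equiv.ofBijective
    (Quotient.mk (SameCycle.setoid (1 : Perm α))) ⟨fun a b h => ?_, Quotient.mk_surjective⟩)).symm
  exact sameCycle_one.1 (Quotient.exact h)

-- Splicing out a moved point flips the sign, adds one cycle and shrinks the support.
omit [Finite α] in
theorem sign_eq_neg_one_pow [Fintype α] (π : Perm α) :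
    sign π = (-1) ^ (Fintype.card α + cycleCount π) := by
  induction hn : π.support.card using Nat.strong_induction_on generalizing π with
  | _ n ih =>
    by_cases h : ∀ v, π v = v
    · have : π = 1 := Perm.ext h
      subst this
      rw [cycleCount_one, Nat.card_eq_fintype_card, Perm.sign_one, ← two_mul, pow_mul]
      simp
    · push Not at h
      obtain ⟨v, hv⟩ := h
      have h1 := ih _ (hn ▸ card_support_swap_mul hv) (swap v (π v) * π) rfl
      have hfix : (swap v (π v) * π) v = v := by simp
      rw [cycleCount_swap_mul hfix hv, ← mul_assoc, swap_mul_self, one_mul, Perm.sign_mul,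
        sign_swap hv.symm, ← add_assoc, pow_succ] at h1
      rw [neg_one_mul, mul_neg_one, neg_inj] at h1
      exact h1

end CycleCount

/-! ### Separation under conjugation and insertion. -/

section Separation

variable {α : Type*}

/-- The points of `M` lie in distinct cycles of `π`. -/
def SeparatesOn (M : Finset α) (π : Perm α) : Prop :=
  ∀ a ∈ M, ∀ b ∈ M, a ≠ b → ¬ π.SameCycle a b

theorem separatesOn_conj_iff {M M' : Finset α} {π : Perm α} (τ : Perm α)
    (hM : ∀ a, τ a ∈ M' ↔ a ∈ M) : SeparatesOn M' (τ * π * τ⁻¹) ↔ SeparatesOn M π := by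
  constructor
  · intro h a ha b hb hab hs
    refine h (τ a) ((hM a).2 ha) (τ b) ((hM b).2 hb) (τ.injective.ne hab) ?_
    simpa [sameCycle_conj] using hs
  · intro h a ha b hb hab hs
    rw [sameCycle_conj] at hs
    refine h _ ?_ _ ?_ ((τ⁻¹).injective.ne hab) hs
    · rw [← hM]; simpa using ha
    · rw [← hM]; simpa using hb

theorem cycleCount_conj (τ π : Perm α) : cycleCount (τ * π * τ⁻¹) = cycleCount π := by
  symm
  refine card_quotient_eq_of_surjective τ (fun a b => ?_) fun b => ⟨τ⁻¹ b, ?_⟩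
  · change SameCycle _ _ _ ↔ SameCycle _ _ _
    rw [sameCycle_conj]
    simp
  · rw [show τ (τ⁻¹ b) = b from τ.apply_symm_apply b]

variable [DecidableEq α]

theorem separatesOn_swap_mul_of_notMem {M : Finset α} {π : Perm α} {v x : α} (hv : π v = v)
    (hx : x ≠ v) (hM : v ∉ M) : SeparatesOn M (swap v x * π) ↔ SeparatesOn M π := by
  have : ∀ a ∈ M, a ≠ v := fun a ha h => hM (h ▸ ha)
  refine forall₂_congr fun a ha => forall₂_congr fun b hb => ?_
  rw [sameCycle_swap_mul_iff hv hx (this a ha) (this b hb)]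

/-- The inserted `v` joins the cycle of `x`, so `x` can stand in for it. -/
theorem separatesOn_swap_mul_of_mem {M : Finset α} {π : Perm α} {v x : α} (hv : π v = v)
    (hM : v ∈ M) (hxM : x ∉ M) :
    SeparatesOn M (swap v x * π) ↔ SeparatesOn (M.map (swap v x).toEmbedding) π := by
  have hx : x ≠ v := fun h => hxM (h ▸ hM)
  have ne : ∀ a ∈ M, swap v x a ≠ v := fun a ha h => by
    rw [swap_apply_eq_iff, swap_apply_left] at h
    exact hxM (h ▸ ha)
  have key : ∀ a ∈ M, (swap v x * π).SameCycle a (swap v x a) := by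
    intro a ha
    by_cases hav : a = v
    · rw [hav, swap_apply_left]
      exact sameCycle_swap_mul_self hv
    · rw [swap_apply_of_ne_of_ne hav (fun h : a = x => hxM (h ▸ ha))]
  have iff : ∀ a ∈ M, ∀ b ∈ M, (swap v x * π).SameCycle a b ↔
      π.SameCycle (swap v x a) (swap v x b) := by
    intro a ha b hb
    rw [← sameCycle_swap_mul_iff hv hx (ne a ha) (ne b hb)]
    exact ⟨fun h => (key a ha).symm.trans (h.trans (key b hb)),
      fun h => (key a ha).trans (h.trans (key b hb).symm)⟩
  constructor
  · intro h a' ha' b' hb' hab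
    obtain ⟨a, ha, rfl⟩ := mem_map.1 ha'
    obtain ⟨b, hb, rfl⟩ := mem_map.1 hb'
    have := h a ha b hb (fun e => hab (e ▸ rfl))
    rwa [iff a ha b hb] at this
  · intro h a ha b hb hab
    rw [iff a ha b hb]
    exact h _ (mem_map_of_mem _ ha) _ (mem_map_of_mem _ hb) ((swap v x).injective.ne hab)

theorem not_separatesOn_swap_mul {M : Finset α} {π : Perm α} {v x : α} (hv : π v = v)
    (hx : x ≠ v) (hM : v ∈ M) (hxM : x ∈ M) : ¬ SeparatesOn M (swap v x * π) :=
  fun h => h v hM x hxM hx.symm (sameCycle_swap_mul_self hv)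

end Separation

/-! ### Counting factorizations by the point that the second factor fixes. -/

section DoubleCounting

variable {α : Type*} [Fintype α] [DecidableEq α]

open Classical in
/-- The number of pairs of long cycles on the complement of `j` whose product has `k` cycles
besides `j` and separates `M`. -/
noncomputable def longPairCount (j : α) (M : Finset α) (k : ℕ) : ℕ :=
  ∑ π : Perm α, if π j = j ∧ cycleCount π = k + 1 ∧ SeparatesOn M π then
    factorCount (univ.erase j) (univ.erase j) π else 0

theorem longPairCount_conj {j j' : α} {M M' : Finset α} (k : ℕ) (τ : Perm α) (hj : τ j = j')
    (hM : ∀ a, τ a ∈ M' ↔ a ∈ M) : longPairCount j' M' k = longPairCount j M k := by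
  classical
  unfold longPairCount
  rw [← Equiv.sum_comp (MulAut.conj τ).toEquiv]
  refine sum_congr rfl fun π _ => ?_
  have h1 : (MulAut.conj τ).toEquiv π = τ * π * τ⁻¹ := rfl
  have h2 : (τ * π * τ⁻¹) j' = j' ↔ π j = j := by
    subst hj
    simp
  have h3 : ∀ a, τ a ∈ univ.erase j' ↔ a ∈ univ.erase j := by
    subst hj
    simp
  rw [h1]
  refine if_congr (and_congr h2 ?_) (factorCount_conj τ π h3 h3) rfl
  rw [cycleCount_conj, separatesOn_conj_iff τ hM]

/-- Sort by `i = π j` and splice `j` out; `i = j` contributes nothing, since the first factor moves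
`j` and the second does not. -/
theorem sum_factorCount_eq_sum_insert (hα : 2 ≤ Fintype.card α) (j : α) (P : Perm α → Prop)
    [DecidablePred P] :
    ∑ π : Perm α, (if P π then factorCount univ (univ.erase j) π else 0) =
      ∑ i ∈ univ.erase j, ∑ π : Perm α, if π j = j ∧ P (swap j i * π) then
        factorCount (univ.erase j) (univ.erase j) π else 0 := by
  have h1 : ∀ π : Perm α, (if P π then factorCount univ (univ.erase j) π else 0) =
      ∑ i ∈ univ.erase j, if π j = i ∧ P π then factorCount univ (univ.erase j) π else 0 := by
    intro π
    by_cases hj : π j = j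
    · obtain ⟨x, hx⟩ := Fintype.exists_ne_of_one_lt_card hα j
      rw [factorCount_eq_zero (mem_univ j) (mem_univ x) hx (notMem_erase _ _) hj]
      simp
    · rw [sum_eq_single_of_mem (π j) (mem_erase.2 ⟨hj, mem_univ _⟩)]
      · simp
      · intro i _ hi
        exact if_neg fun h => hi h.1.symm
  rw [sum_congr rfl fun π _ => h1 π, sum_comm]
  refine sum_congr rfl fun i hi => ?_
  have hij := ne_of_mem_erase hi
  rw [← Equiv.sum_comp (Equiv.mulLeft (swap j i))]
  refine sum_congr rfl fun π _ => ?_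
  have h2 : (swap j i * π) j = i ↔ π j = j := by
    rw [Perm.mul_apply, swap_apply_eq_iff, swap_apply_right]
  rw [Equiv.coe_mulLeft]
  by_cases hj : π j = j
  · have h3 := h2.2 hj
    refine if_congr (and_congr_left' h2) ?_ rfl
    rw [factorCount_delete (mem_univ j) (mem_univ _) (notMem_erase _ _) (by rw [h3]; exact hij),
      h3, ← mul_assoc, swap_mul_self, one_mul]
  · rw [if_neg fun h => hj (h2.1 h.1), if_neg fun h => hj h.1]

open Classical in
theorem sum_separatesOn_factorCount (hα : 2 ≤ Fintype.card α) (M : Finset α) (k : ℕ) {l : α}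
    (hl : l ∉ M) :
    ∑ j, ∑ π : Perm α, (if cycleCount π = k ∧ SeparatesOn M π then
        factorCount univ (univ.erase j) π else 0) =
      (Mᶜ.card * (Fintype.card α - 1) + M.card * Mᶜ.card) * longPairCount l M k := by
  -- Conjugation by `swap l i` fixes `M` pointwise.
  have hcomp : ∀ i ∉ M, longPairCount i M k = longPairCount l M k := by
    intro i hi
    refine longPairCount_conj k (swap l i) (swap_apply_left _ _) fun a => ?_
    by_cases h1 : a = l
    · subst h1; simp [hi, hl]
    by_cases h2 : a = i
    · subst h2; simp [hi, hl]
    · rw [swap_apply_of_ne_of_ne h1 h2]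
  have hnot : ∀ j ∉ M, ∑ π : Perm α, (if cycleCount π = k ∧ SeparatesOn M π then
      factorCount univ (univ.erase j) π else 0) =
        (Fintype.card α - 1) * longPairCount l M k := by
    intro j hj
    rw [sum_factorCount_eq_sum_insert hα j, ← hcomp j hj]
    rw [sum_congr rfl (g := fun _ => longPairCount j M k), sum_const,
      card_erase_of_mem (mem_univ _), card_univ, smul_eq_mul]
    intro i hi
    refine sum_congr rfl fun π _ => if_congr (and_congr_right fun hπ => ?_) rfl rfl
    rw [separatesOn_swap_mul_of_notMem hπ (ne_of_mem_erase hi) hj,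
      cycleCount_swap_mul hπ (ne_of_mem_erase hi), Nat.add_right_cancel_iff]
  have hmem : ∀ j ∈ M, ∑ π : Perm α, (if cycleCount π = k ∧ SeparatesOn M π then
      factorCount univ (univ.erase j) π else 0) = Mᶜ.card * longPairCount l M k := by
    intro j hj
    rw [sum_factorCount_eq_sum_insert hα j, ← sum_subset (s₁ := Mᶜ)]
    · rw [sum_congr rfl (g := fun _ => longPairCount l M k), sum_const, smul_eq_mul]
      intro i hi
      rw [mem_compl] at hi
      have hij : i ≠ j := fun h => hi (h ▸ hj)
      rw [← hcomp i hi]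
      trans longPairCount j (M.map (swap j i).toEmbedding) k
      · refine sum_congr rfl fun π _ => if_congr (and_congr_right fun hπ => ?_) rfl rfl
        rw [separatesOn_swap_mul_of_mem hπ hj hi, cycleCount_swap_mul hπ hij,
          Nat.add_right_cancel_iff]
      · refine longPairCount_conj k (swap j i) (swap_apply_right _ _) fun a => ?_
        rw [mem_map_equiv, symm_swap, swap_apply_self]
    · intro i hi
      rw [mem_compl] at hi
      exact mem_erase.2 ⟨fun h => hi (h ▸ hj), mem_univ _⟩
    · intro i hi hiM
      rw [mem_compl, not_not] at hiM
      refine sum_eq_zero fun π _ => if_neg ?_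
      rintro ⟨hπ, -, h⟩
      exact not_separatesOn_swap_mul hπ (ne_of_mem_erase hi) hj hiM h
  rw [← sum_add_sum_compl M, sum_congr rfl hmem,
    sum_congr rfl fun j hj => hnot j (mem_compl.1 hj), sum_const, sum_const, smul_eq_mul,
    smul_eq_mul]
  ring

end DoubleCounting

/-! ### Permutations of `[n]` as permutations of `[n + 1]` fixing the last point. -/

section Transport

variable {n : ℕ}

/-- A permutation of `Fin n`, extended to `Fin (n + 1)` by fixing the last element. -/
noncomputable def extendLast (n : ℕ) : Perm (Fin n) →* Perm (Fin (n + 1)) :=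
  Perm.extendDomainHom (finSuccAboveEquiv (Fin.last n))

theorem extendLast_castSucc (π : Perm (Fin n)) (a : Fin n) :
    extendLast n π a.castSucc = (π a).castSucc := by
  change π.extendDomain (finSuccAboveEquiv (Fin.last n)) _ = _
  have := Perm.extendDomain_apply_image π (finSuccAboveEquiv (Fin.last n)) a
  simpa [finSuccAboveEquiv_apply] using this

theorem extendLast_last (π : Perm (Fin n)) : extendLast n π (Fin.last n) = Fin.last n :=
  Perm.extendDomain_apply_not_subtype π _ (by simp)

theorem sameCycle_extendLast (π : Perm (Fin n)) (a b : Fin n) :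
    (extendLast n π).SameCycle a.castSucc b.castSucc ↔ π.SameCycle a b := by
  change (π.extendDomain (finSuccAboveEquiv (Fin.last n))).SameCycle _ _ ↔ _
  have := sameCycle_extendDomain (g := π) (f := (finSuccAboveEquiv (Fin.last n)))
    (x := a) (y := b)
  simpa [finSuccAboveEquiv_apply] using this

theorem extendLast_injective : Function.Injective (extendLast n) :=
  Perm.extendDomainHom_injective _

theorem exists_extendLast_eq {σ : Perm (Fin (n + 1))} (h : σ (Fin.last n) = Fin.last n) :
    ∃ π, extendLast n π = σ := by
  have h' : ∀ x, σ x ≠ Fin.last n ↔ x ≠ Fin.last n := fun x => by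
    rw [not_iff_not, ← σ.injective.eq_iff (a := x), h]
  refine ⟨(finSuccAboveEquiv (Fin.last n)).symm.permCongr (σ.subtypePerm h'), ?_⟩
  ext x
  refine Fin.lastCases ?_ (fun a => ?_) x
  · rw [extendLast_last, h]
  · have key : ∀ y, (finSuccAboveEquiv (Fin.last n) y : Fin (n + 1)) = y.castSucc := by
      simp [finSuccAboveEquiv_apply]
    rw [extendLast_castSucc, ← key, Equiv.permCongr_apply, Equiv.symm_symm,
      Equiv.apply_symm_apply, Perm.subtypePerm_apply, ← key]

theorem cycleCount_extendLast (π : Perm (Fin n)) :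
    cycleCount (extendLast n π) = numCycles π + 1 := by
  refine card_quotient_eq_add_one Fin.castSucc (Fin.last n) (sameCycle_extendLast π)
    (fun a => not_sameCycle_of_fixed (extendLast_last π) (Fin.castSucc_ne_last a)) fun b => ?_
  refine Fin.lastCases ?_ (fun a => ?_) b
  · exact Or.inl (SameCycle.refl _ _)
  · exact Or.inr ⟨a, SameCycle.refl _ _⟩

theorem longOn_extendLast_iff (π : Perm (Fin n)) :
    LongOn (univ.erase (Fin.last n)) (extendLast n π) ↔ IsLongCycle π := by
  constructor
  · intro h
    refine ⟨Set.bijOn_univ.2 π.bijective, fun a _ b _ => ?_⟩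
    rw [← sameCycle_extendLast]
    exact h.2 _ (by simp) _ (by simp)
  · intro h
    refine ⟨fun a ha => ?_, fun a ha b hb => ?_⟩
    · have : a = Fin.last n := by simpa using ha
      rw [this, extendLast_last]
    · obtain ⟨a, rfl⟩ := Fin.exists_castSucc_eq.2 (ne_of_mem_erase ha)
      obtain ⟨b, rfl⟩ := Fin.exists_castSucc_eq.2 (ne_of_mem_erase hb)
      rw [sameCycle_extendLast]
      exact h.2 (Set.mem_univ _) (Set.mem_univ _)

/-- The first `m` elements of `Fin n`. -/
def initial (n m : ℕ) : Finset (Fin n) := univ.filter fun i => i.val < m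

theorem separatesOn_initial_iff (m : ℕ) (π : Perm (Fin n)) :
    SeparatesOn (initial n m) π ↔ Separates m π := by
  simp only [SeparatesOn, Separates, initial, mem_filter, mem_univ, true_and]
  exact forall_congr' fun a => ⟨fun h b ha hb => h ha b hb, fun h ha b hb => h b ha hb⟩

theorem separatesOn_extendLast_iff {m : ℕ} (hm : m ≤ n) (π : Perm (Fin n)) :
    SeparatesOn (initial (n + 1) m) (extendLast n π) ↔ Separates m π := by
  constructor
  · intro h a b ha hb hab
    rw [← sameCycle_extendLast]
    exact h _ (by simpa [initial] using ha) _ (by simpa [initial] using hb)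
      ((Fin.castSucc_injective n).ne hab)
  · intro h a ha b hb hab
    simp only [initial, mem_filter, mem_univ, true_and] at ha hb
    obtain ⟨a, rfl⟩ := Fin.exists_castSucc_eq.2 (show a ≠ Fin.last n by
      rintro rfl; simp at ha; omega)
    obtain ⟨b, rfl⟩ := Fin.exists_castSucc_eq.2 (show b ≠ Fin.last n by
      rintro rfl; simp at hb; omega)
    rw [sameCycle_extendLast]
    exact h a b ha hb (fun e => hab (e ▸ rfl))

theorem IsLongCycle.inv {s : Perm (Fin n)} (h : IsLongCycle s) : IsLongCycle s⁻¹ :=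
  IsCycleOn.inv h

theorem longPairCount_eq_planeCount {m : ℕ} (hm : m ≤ n) (k : ℕ) :
    longPairCount (Fin.last n) (initial (n + 1) m) k = planeCount m n k := by
  classical
  let E := (univ : Finset (Fin (n + 1))).erase (Fin.last n)
  have h1 : longPairCount (Fin.last n) (initial (n + 1) m) k =
      Nat.card {q : Perm (Fin (n + 1)) × Perm (Fin (n + 1)) //
        (q.1 (Fin.last n) = Fin.last n ∧ cycleCount q.1 = k + 1 ∧
          SeparatesOn (initial (n + 1) m) q.1) ∧ LongOn E q.2 ∧ LongOn E (q.2⁻¹ * q.1)} := by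
    rw [Nat.card_eq_fintype_card, Fintype.card_subtype, card_filter, Fintype.sum_prod_type]
    refine sum_congr rfl fun π _ => ?_
    rw [factorCount]
    split_ifs with h
    · exact sum_congr rfl fun s _ => if_congr (by simp [h, E]) rfl rfl
    · exact (sum_eq_zero fun s _ => if_neg fun h' => h h'.1).symm
  rw [h1, planeCount]
  symm
  -- From `D = s π⁻¹` comes `π = D⁻¹ s`, so `D⁻¹` is the first factor and `s` the second.
  have key : ∀ p : PlanePermutation n, (extendLast n p.diagonal⁻¹)⁻¹ * extendLast n p.vertical =
      extendLast n p.s := by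
    intro p
    rw [← map_inv, ← map_mul, inv_inv, PlanePermutation.diagonal, inv_mul_cancel_right]
  refine Nat.card_congr (Equiv.ofBijective (fun p =>
    ⟨(extendLast n p.1.vertical, extendLast n p.1.diagonal⁻¹), ⟨⟨extendLast_last _, ?_, ?_⟩,
      ?_, ?_⟩⟩) ⟨?_, ?_⟩)
  · rw [cycleCount_extendLast, p.2.2.1]
  · exact (separatesOn_extendLast_iff hm _).2 p.2.2.2
  · exact (longOn_extendLast_iff _).2 p.2.1.inv
  · rw [key]
    exact (longOn_extendLast_iff _).2 p.1.isLongCycle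
  · rintro ⟨⟨s, π, hs⟩, hp⟩ ⟨⟨s', π', hs'⟩, hp'⟩ h
    simp only [Subtype.mk.injEq, Prod.mk.injEq, extendLast_injective.eq_iff,
      PlanePermutation.diagonal, inv_inj] at h
    obtain ⟨rfl, h⟩ := h
    obtain rfl := mul_right_cancel h
    rfl
  · rintro ⟨⟨π, d⟩, ⟨hπ, hk, hsep⟩, hd, hs⟩
    obtain ⟨π, rfl⟩ := exists_extendLast_eq hπ
    obtain ⟨d, rfl⟩ := exists_extendLast_eq (hd.1 (Fin.last n) (notMem_erase _ _))
    rw [← map_inv, ← map_mul] at hs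
    have e : (d⁻¹ * π) * π⁻¹ = d⁻¹ := by group
    refine ⟨⟨⟨d⁻¹ * π, π, (longOn_extendLast_iff _).1 hs⟩, ?_, ?_, ?_⟩, ?_⟩
    · rw [PlanePermutation.diagonal, e]
      exact ((longOn_extendLast_iff _).1 hd).inv
    · simpa [cycleCount_extendLast] using hk
    · exact (separatesOn_extendLast_iff hm _).1 hsep
    · simp [PlanePermutation.diagonal]

end Transport

theorem planeCount_mul {n m k : ℕ} (hn : 1 ≤ n) (hm : m ≤ n)
    (hk : Even ((n : ℤ) - (k : ℤ))) :
    (n + m) * (n + 1 - m) * planeCount m n k =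
      2 * (n - 1).factorial * sepCount m (n + 1) k := by
  classical
  have hM : (initial (n + 1) m).card = m := by
    rw [initial, Fin.card_filter_val_lt]
    omega
  have hl : Fin.last n ∉ initial (n + 1) m := by simpa [initial] using hm
  have h := sum_separatesOn_factorCount (α := Fin (n + 1)) (by simp; omega) (initial (n + 1) m) k
    hl
  rw [card_compl, hM, Fintype.card_fin, longPairCount_eq_planeCount hm, sum_comm] at h
  have hs : sepCount m (n + 1) k = (univ.filter fun π : Perm (Fin (n + 1)) =>
      cycleCount π = k ∧ SeparatesOn (initial (n + 1) m) π).card := by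
    rw [sepCount, Nat.card_eq_fintype_card, Fintype.card_subtype]
    refine congrArg card (filter_congr fun π _ => ?_)
    rw [separatesOn_initial_iff]
    rfl
  -- The parity hypothesis makes every counted permutation of `[n + 1]` odd, as Boccara's theorem
  -- requires.
  have hodd : Odd (n + 1 + k) := by
    have : Even (n + k) := by
      rw [Int.even_sub] at hk
      rw [Nat.even_add]
      exact_mod_cast hk
    rw [add_right_comm]
    exact this.add_one
  have inner : ∀ π : Perm (Fin (n + 1)),
      ∑ j, (if cycleCount π = k ∧ SeparatesOn (initial (n + 1) m) π then
        factorCount univ (univ.erase j) π else 0) =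
      if cycleCount π = k ∧ SeparatesOn (initial (n + 1) m) π then 2 * (n - 1).factorial
        else 0 := by
    intro π
    split_ifs with hπ
    · refine sum_factorCount_erase (n - 1) (by simp; omega) (by simp) ?_
      rw [sign_eq_neg_one_pow, hπ.1, Fintype.card_fin, hodd.neg_one_pow]
    · exact sum_const_zero
  rw [sum_congr rfl fun π _ => inner π, ← sum_filter, sum_const, ← hs, smul_eq_mul] at h
  rw [mul_comm (2 * _), h, Nat.add_sub_cancel]
  ring

end PlanePerm

theorem mainTheorem1 (n m k : ℕ) (hn : 1 ≤ n) (hm : m ≤ n) (hk : Even ((n : ℤ) - (k : ℤ))) :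
    (PlanePerm.planeCount m n k : ℚ) =
      2 * (Nat.factorial (n - 1) : ℚ) * (PlanePerm.sepCount m (n + 1) k : ℚ) /
        (((n : ℚ) + (m : ℚ)) * ((n : ℚ) + 1 - (m : ℚ))) := by
  have h := congrArg (Nat.cast : ℕ → ℚ) (PlanePerm.planeCount_mul hn hm hk)
  push_cast [Nat.cast_sub (show m ≤ n + 1 by omega)] at h
  have hn' : (1 : ℚ) ≤ n := by exact_mod_cast hn
  have hm' : (m : ℚ) ≤ n := by exact_mod_cast hm
  have hm0 : (0 : ℚ) ≤ m := m.cast_nonneg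
  rw [eq_div_iff (mul_pos (by linarith) (by linarith)).ne', ← h]
  ring
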